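/- For $k\ge 0$ let $\ell_2^k=\ell_2(\mathbb Z;\mathbb R^k)$. A bounded operator $A:\ell_2^k\to\ell_2^l$ has a doubly infinite matrix of $l\times k$ blocks $A_{ij}$, $i,j\in\mathbb Z$. A block matrix is \emph{time-invariant} if it is block Toeplitz, $A_{i+1,j+1}=A_{ij}$, and \emph{causal} (\emph{strictly causal}) if $A_{ij}=0$ for $i<j$ (for $i\le j$). Write $\{A\}_+$ for its causal part (the blocks with $j\le i$) and $\{A\}_-$ for its strictly anti-causal part (the blocks with $i<j$). The norm $\|B\|$ of a block matrix $B$ is the operator norm of the bounded operator with that block matrix, and $\infty$ if there is none. Let $\mathcal P_{11}:\ell_2^n\to\ell_2^q$, $\mathcal P_{12}:\ell_2^m\to\ell_2^q$, $\mathcal P_{21}:\ell_2^n\to\ell_2^p$ be bounded, strictly causal and time-invariant. For a bounded time-invariant $\mathcal Q:\ell_2^p\to\ell_2^m$ (Youla parameter) let $$T_{\mathcal Q}=\begin{pmatrix}\mathcal P_{11}+\mathcal P_{12}\mathcal Q\mathcal P_{21}&\mathcal P_{12}\mathcal Q\\ \mathcal Q\mathcal P_{21}&\mathcal Q\end{pmatrix},\qquad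 J(\mathcal Q,w,v)=\Big\|T_{\mathcal Q}\begin{pmatrix}w\\v\end{pmatrix}\Big\|^2 .$$ Fix any bounded time-invariant, possibly non-causal, reference controller $\mathcal Q_0:\ell_2^p\to\ell_2^m$, and put $$\rho(\mathcal Q)=\sup_{(w,v)\ne 0}\frac{J(\mathcal Q,w,v)-J(\mathcal Q_0,w,v)}{\|w\|_2^2+\|v\|_2^2},\qquad \rho^\star=\inf\{\rho(\mathcal Q):\mathcal Q\text{ bounded, time-invariant and causal}\}.$$ For $\gamma>0$, a \emph{$\gamma$-solution} is a bounded, time-invariant, causal $\mathcal Q$ with $\rho(\mathcal Q)\le\gamma^2$. Let $$\mathcal T=I+\mathcal P_{12}^*\mathcal P_{12},\qquad \mathcal Q_2=-\mathcal T^{-1}\mathcal P_{12}^*\mathcal P_{11}\mathcal P_{21}^*(I+\mathcal P_{21}\mathcal P_{21}^*)^{-1},$$ $$\mathcal M=\gamma^{-2}I+\gamma^{-2}\mathcal P_{12}^*\big(I+\gamma^{-2}\mathcal P_{11}(I+\mathcal P_{21}^*\mathcal P_{21})^{-1}\mathcal P_{11}^*\big)\mathcal P_{12},$$ $$\mathcal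 W=(I+\mathcal P_{21}\mathcal P_{21}^*)^{-1}+\gamma^{-4}(\mathcal Q_2-\mathcal Q_0)^*\mathcal T\mathcal M^{-1}\mathcal T(\mathcal Q_2-\mathcal Q_0),$$ and let canonical factorizations $\mathcal M=\mathcal M^{*/2}\mathcal M^{1/2}$, $\mathcal W=\mathcal W^{*/2}\mathcal W^{1/2}$ be given, in which $\mathcal M^{1/2}$, $\mathcal W^{1/2}$ are bounded, time-invariant, causal and have bounded causal inverses $\mathcal M^{-1/2}$, $\mathcal W^{-1/2}$, and $\mathcal M^{*/2}=(\mathcal M^{1/2})^*$, $\mathcal W^{*/2}=(\mathcal W^{1/2})^*$, $\mathcal M^{-*/2}=(\mathcal M^{-1/2})^*$. Put $$\mathcal X=\mathcal M^{1/2}\mathcal Q_0\mathcal W^{-1/2}+\gamma^{-2}\mathcal M^{-*/2}\mathcal T(\mathcal Q_2-\mathcal Q_0)\mathcal W^{-1/2}.$$ Then: 1. $\mathcal Q_2$ is the optimal non-causal $H_2$ controller: it is time-invariant and, among all bounded time-invariant $\mathcal Q$, it is the unique minimizer of the $H_2$ norm of $T_{\mathcal Q}$, i.e. of its Frobenius norm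 per time step (the Frobenius norm of the block column of time $0$). 2. A $\gamma$-solution exists if and only if $\inf_{\mathcal C}\|\mathcal C-\{\mathcal X\}_-\|\le 1$, the infimum being over the causal block Toeplitz matrices $\mathcal C$; and also if and only if there is a causal block Toeplitz $\mathcal C$ with $\|\mathcal C-\{\mathcal X\}_-\|\le 1$. 3. The optimal regret $\rho^\star$ is equal to $\gamma^2$ if and only if $\gamma$-solutions exist and all of them satisfy $\rho(\mathcal Q)=\gamma^2$. 4. If $\mathcal C$ is causal block Toeplitz with $\|\mathcal C-\{\mathcal X\}_-\|\le 1$, then $\mathcal C+\{\mathcal X\}_+$ is the block matrix of a bounded operator, and $\mathcal Q_c=\mathcal M^{-1/2}(\mathcal C+\{\mathcal X\}_+)\mathcal W^{1/2}$ is a $\gamma$-solution; if moreover $\rho^\star=\gamma^2$, then $\rho(\mathcal Q_c)=\rho^\star$, so $\mathcal Q_c$ is regret-optimal. -/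

import Mathlib

open scoped ENNReal

noncomputable section

namespace RegretControl

/-- Doubly infinite square-summable sequences with values in `ℝ^k`. -/
abbrev Sig (k : ℕ) : Type := lp (fun _ : ℤ => EuclideanSpace ℝ (Fin k)) 2

/-- Bounded operators between spaces of doubly infinite sequences. -/
abbrev Op (k l : ℕ) : Type := Sig k →L[ℝ] Sig l

/-- Doubly infinite block matrices with blocks of size `l × k`, not assumed to be bounded. -/
abbrev BlockMatrix (k l : ℕ) : Type := ℤ → ℤ → Matrix (Fin l) (Fin k) ℝ

/-- The signal that is the `b`-th unit vector at time `j` and zero at all other times. -/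
def impulse {k : ℕ} (j : ℤ) (b : Fin k) : Sig k :=
  lp.single 2 j (EuclideanSpace.single b (1 : ℝ))

/-- The block matrix of a bounded operator: the block `(i, j)` maps the input at time `j` to the
output at time `i`. -/
def blocks {k l : ℕ} (A : Op k l) : BlockMatrix k l :=
  fun i j => Matrix.of fun a b => (A (impulse j b)) i a

namespace BlockMatrix

variable {k l : ℕ}

/-- Block Toeplitz. -/
def IsToeplitz (B : BlockMatrix k l) : Prop := ∀ i j, B (i + 1) (j + 1) = B i j

/-- Causal: block lower triangular. -/
def IsCausal (B : BlockMatrix k l) : Prop := ∀ i j, i < j → B i j = 0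

/-- Strictly causal: strictly block lower triangular. -/
def IsStrictlyCausal (B : BlockMatrix k l) : Prop := ∀ i j, i ≤ j → B i j = 0

/-- The causal part `{B}₊`. -/
def causalPart (B : BlockMatrix k l) : BlockMatrix k l :=
  fun i j => if j ≤ i then B i j else 0

/-- The strictly anti-causal part `{B}₋`. -/
def antiPart (B : BlockMatrix k l) : BlockMatrix k l :=
  fun i j => if i < j then B i j else 0

/-- The operator norm of a block matrix, which is `∞` if the block matrix is not the matrix of a
bounded operator. (A bounded operator is determined by its block matrix.) -/
def opNorm (B : BlockMatrix k l) : ℝ≥0∞ := ⨅ (A : Op k l) (_ : blocks A = B), ‖A‖ₑ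

end BlockMatrix

/-- A time-invariant operator. -/
def IsTimeInvariant {k l : ℕ} (A : Op k l) : Prop := BlockMatrix.IsToeplitz (blocks A)

/-- A causal operator. -/
def IsCausal {k l : ℕ} (A : Op k l) : Prop := BlockMatrix.IsCausal (blocks A)

/-- A strictly causal operator. -/
def IsStrictlyCausal {k l : ℕ} (A : Op k l) : Prop := BlockMatrix.IsStrictlyCausal (blocks A)

/-- The adjoint operator. -/
abbrev adj {k l : ℕ} (A : Op k l) : Op l k := ContinuousLinearMap.adjoint A

/-- `R` is a canonical factor of `A`: `A = R* R` with `R` time-invariant, causal and boundedly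
invertible with causal inverse. -/
structure IsCanonicalFactor {k : ℕ} (A R : Op k k) : Prop where
  timeInvariant : IsTimeInvariant R
  isUnit : IsUnit R
  causal : IsCausal R
  causal_inverse : IsCausal (Ring.inverse R)
  factor : adj R ∘L R = A

/-- A linear time-invariant plant `s = P₁₁ w + P₁₂ u`, `y = P₂₁ w + P₂₂ u + v` with disturbance
`w ∈ ℝⁿ`, control `u ∈ ℝᵐ`, measurement `y` and measurement noise `v` in `ℝᵖ`, regulated signal
`s ∈ ℝ^q`, the weights of the cost being absorbed in `s` and `u`. The closed loop depends on `P₂₂`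
and the feedback law only through the Youla parameter, so `P₂₂` is not recorded. -/
structure Plant (n m p q : ℕ) where
  P₁₁ : Op n q
  P₁₂ : Op m q
  P₂₁ : Op n p
  timeInvariant₁₁ : IsTimeInvariant P₁₁
  timeInvariant₁₂ : IsTimeInvariant P₁₂
  timeInvariant₂₁ : IsTimeInvariant P₂₁
  strictlyCausal₁₁ : IsStrictlyCausal P₁₁
  strictlyCausal₁₂ : IsStrictlyCausal P₁₂
  strictlyCausal₂₁ : IsStrictlyCausal P₂₁

namespace Plant

variable {n m p q : ℕ} (P : Plant n m p q)

/-- The regulated signal `s` of the closed loop, the first component of `T_Q (w, v)`. -/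
def regulated (Q : Op p m) (w : Sig n) (v : Sig p) : Sig q :=
  (P.P₁₁ + P.P₁₂ ∘L Q ∘L P.P₂₁) w + (P.P₁₂ ∘L Q) v

/-- The control signal `u` of the closed loop, the second component of `T_Q (w, v)`. -/
def control (Q : Op p m) (w : Sig n) (v : Sig p) : Sig m :=
  (Q ∘L P.P₂₁) w + Q v

/-- The cost `J(Q, w, v) = s* s + u* u = ‖T_Q (w, v)‖²`. -/
def cost (Q : Op p m) (w : Sig n) (v : Sig p) : ℝ :=
  ‖P.regulated Q w v‖ ^ 2 + ‖P.control Q w v‖ ^ 2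

/-- The regret of `Q` with respect to the reference controller `Q₀`. -/
def regret (Q₀ Q : Op p m) (w : Sig n) (v : Sig p) : ℝ := P.cost Q w v - P.cost Q₀ w v

/-- The worst-case regret ratio of `Q` with respect to `Q₀`. -/
def worstRegret (Q₀ Q : Op p m) : EReal :=
  ⨆ (w : Sig n) (v : Sig p) (_ : ¬(w = 0 ∧ v = 0)),
    ((P.regret Q₀ Q w v / (‖w‖ ^ 2 + ‖v‖ ^ 2) : ℝ) : EReal)

/-- The optimal regret over causal time-invariant controllers. -/
def optimalRegret (Q₀ : Op p m) : EReal :=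
  ⨅ (Q : Op p m) (_ : IsTimeInvariant Q) (_ : IsCausal Q), P.worstRegret Q₀ Q

/-- `Q` is a `γ`-solution of the causal regret problem with respect to `Q₀`. -/
structure IsGammaSolution (Q₀ : Op p m) (γ : ℝ) (Q : Op p m) : Prop where
  timeInvariant : IsTimeInvariant Q
  causal : IsCausal Q
  worstRegret_le : P.worstRegret Q₀ Q ≤ ((γ ^ 2 : ℝ) : EReal)

/-- The squared `H₂` norm of `T_Q`, that is, its squared Frobenius norm per time step: the sum of the
squares of all the entries of `T_Q` in the block column of time `0`. -/
def h2Cost (Q : Op p m) : ℝ :=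
  ∑ b : Fin n, P.cost Q (impulse 0 b) 0 + ∑ b : Fin p, P.cost Q 0 (impulse 0 b)

/-- `T = I + P₁₂* P₁₂`. -/
def opT : Op m m := 1 + adj P.P₁₂ ∘L P.P₁₂

/-- The non-causal controller `Q₂ = -T⁻¹ P₁₂* P₁₁ P₂₁* (I + P₂₁ P₂₁*)⁻¹`. -/
def Q₂ : Op p m :=
  -(Ring.inverse P.opT ∘L adj P.P₁₂ ∘L P.P₁₁ ∘L adj P.P₂₁ ∘L
    Ring.inverse (1 + P.P₂₁ ∘L adj P.P₂₁))

/-- `M = γ⁻² I + γ⁻² P₁₂* (I + γ⁻² P₁₁ (I + P₂₁* P₂₁)⁻¹ P₁₁*) P₁₂`. -/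
def opM (γ : ℝ) : Op m m :=
  (γ ^ 2)⁻¹ • (1 : Op m m) + (γ ^ 2)⁻¹ • (adj P.P₁₂ ∘L
    (1 + (γ ^ 2)⁻¹ • (P.P₁₁ ∘L Ring.inverse (1 + adj P.P₂₁ ∘L P.P₂₁) ∘L adj P.P₁₁)) ∘L P.P₁₂)

/-- `W = (I + P₂₁ P₂₁*)⁻¹ + γ⁻⁴ (Q₂ - Q₀)* T M⁻¹ T (Q₂ - Q₀)`. -/
def opW (Q₀ : Op p m) (γ : ℝ) : Op p p :=
  Ring.inverse (1 + P.P₂₁ ∘L adj P.P₂₁) + (γ ^ 4)⁻¹ •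
    (adj (P.Q₂ - Q₀) ∘L P.opT ∘L Ring.inverse (P.opM γ) ∘L P.opT ∘L (P.Q₂ - Q₀))

/-- `X = M^{1/2} Q₀ W^{-1/2} + γ⁻² M^{-*/2} T (Q₂ - Q₀) W^{-1/2}`, where `Mh` and `Wh` are the
factors `M^{1/2}` and `W^{1/2}`. -/
def opX (Q₀ : Op p m) (γ : ℝ) (Mh : Op m m) (Wh : Op p p) : Op p m :=
  Mh ∘L Q₀ ∘L Ring.inverse Wh + (γ ^ 2)⁻¹ •
    (adj (Ring.inverse Mh) ∘L P.opT ∘L (P.Q₂ - Q₀) ∘L Ring.inverse Wh)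

end Plant

/-- The value `inf ‖C - Z‖` of the Nehari problem over causal block Toeplitz `C`. If the given
block Toeplitz matrix `Z` is that of a bounded operator, then only bounded `C` contribute. -/
def nehariValue {k l : ℕ} (Z : BlockMatrix k l) : ℝ≥0∞ :=
  ⨅ (C : BlockMatrix k l) (_ : C.IsToeplitz) (_ : C.IsCausal), (C - Z).opNorm

/-- `C` is a solution with norm at most one of the Nehari problem for `Z`. -/
structure IsNehariSolution {k l : ℕ} (Z C : BlockMatrix k l) : Prop where
  toeplitz : C.IsToeplitz
  causal : C.IsCausal
  opNorm_le : (C - Z).opNorm ≤ 1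

end RegretControl

end

/-! Fix the measurement `y = P₂₁ w + v`. The pairs `(w, v)` producing `y` form an affine space, and
on it `γ²(‖w‖² + ‖v‖²)` minus the regret is a quadratic polynomial. Completing squares over the
disturbance and then over the control (`Plant.completed_squares`) leaves a nonnegative term, which a
suitable `w` annihilates, plus `γ²(⟨W y, y⟩ - ⟨M z, z⟩)` with `z = (Q - Q₀) y - γ⁻² M⁻¹ T (Q₂ - Q₀)
y`. With the canonical factors, regret at most `γ²` becomes `‖M^{1/2} Q W^{-1/2} - X‖ ≤ 1`
(`Plant.worstRegret_le_sq_iff`).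

Since the factors and their inverses are causal and time-invariant, `M^{1/2} Q W^{-1/2}` runs over
all causal time-invariant operators as `Q` does. Subtracting `{X}₊` gives the Nehari problem for
`{X}₋`. The causal part of a bounded operator may be unbounded, so this is done with block matrices;
only `C - {X}₋`, and hence `C + {X}₊`, is bounded.

Both the Nehari infimum and the optimal regret are handled by weak compactness
(`exists_weak_limit`): causality and time-invariance are conditions on single matrix entries, and
norms are weakly lower semicontinuous.

The `H₂` claim is separate: the cost is a strictly convex quadratic in `Q` for the inner product
`frob`, and `Q₂` solves its normal equation. -/

open scoped ENNReal

noncomputable section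

namespace RegretControl

/-! ### Block matrices, shifts, time-invariance and causality -/

section Basic

variable {k l r : ℕ}

lemma inner_impulse_left (i : ℤ) (a : Fin k) (x : Sig k) : inner ℝ (impulse i a) x = x i a := by
  rw [impulse, lp.inner_single_left, EuclideanSpace.inner_single_left]
  simp

lemma op_ext {A B : Op k l} (h : ∀ j b, A (impulse j b) = B (impulse j b)) : A = B := by
  refine lp.ext_continuousLinearMap (by simp) fun j => ?_
  refine ContinuousLinearMap.coe_injective ?_
  refine (EuclideanSpace.basisFun (Fin k) ℝ).toBasis.ext fun b => ?_
  simpa [impulse] using h j b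

lemma blocks_apply (A : Op k l) (i j : ℤ) (a : Fin l) (b : Fin k) :
    blocks A i j a b = A (impulse j b) i a := rfl

lemma blocks_injective : Function.Injective (blocks : Op k l → BlockMatrix k l) := by
  intro A B h
  refine op_ext fun j b => ?_
  refine lp.ext (funext fun i => PiLp.ext fun a => ?_)
  exact congrFun (congrFun (congrFun (congrFun h i) j) a) b

@[simp] lemma blocks_add (A B : Op k l) : blocks (A + B) = blocks A + blocks B := rfl

@[simp] lemma blocks_sub (A B : Op k l) : blocks (A - B) = blocks A - blocks B := rfl

lemma blocks_adj (A : Op k l) (i j : ℤ) (a : Fin k) (b : Fin l) :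
    blocks (adj A) i j a b = blocks A j i b a := by
  rw [blocks_apply, blocks_apply, ← inner_impulse_left, ContinuousLinearMap.adjoint_inner_right,
    real_inner_comm, inner_impulse_left]

/-- The shift by `s` time steps. -/
def shift (s : ℤ) : Op k k :=
  LinearMap.mkContinuous
    { toFun := fun x => ⟨fun i => x (i - s), by
        refine memℓp_gen ?_
        have h := (lp.memℓp x).summable (by simp)
        exact (Equiv.subRight s).summable_iff.2 h⟩
      map_add' := fun x y => rfl
      map_smul' := fun c x => rfl } 1 (by
    intro x
    rw [one_mul]
    refine le_of_eq ?_
    rw [lp.norm_eq_tsum_rpow (by simp), lp.norm_eq_tsum_rpow (by simp)]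
    congr 1
    exact (Equiv.subRight s).tsum_eq (fun i => ‖x i‖ ^ (2 : ℝ≥0∞).toReal))

lemma shift_apply (s : ℤ) (x : Sig k) (i : ℤ) : shift s x i = x (i - s) := rfl

lemma shift_shift_neg (s : ℤ) (x : Sig k) : shift s (shift (-s) x) = x := by
  refine lp.ext (funext fun i => ?_)
  simp [shift_apply]

lemma shift_neg_shift (s : ℤ) (x : Sig k) : shift (-s) (shift s x) = x := by
  refine lp.ext (funext fun i => ?_)
  simp [shift_apply]

lemma inner_shift_left (s : ℤ) (x y : Sig k) :
    inner ℝ (shift s x) y = inner ℝ x (shift (-s) y) := by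
  rw [lp.inner_eq_tsum, lp.inner_eq_tsum,
    ← (Equiv.subRight s).tsum_eq (fun i => inner ℝ (x i) (shift (-s) y i))]
  simp [shift_apply]

lemma shift_impulse (s j : ℤ) (b : Fin k) : shift s (impulse j b) = impulse (j + s) b := by
  refine lp.ext (funext fun i => ?_)
  simp only [shift_apply, impulse, lp.single_apply, Pi.single_apply, sub_eq_iff_eq_add]

/-- Commutation with the shift passes directly to compositions, adjoints and inverses, with no
infinite sums of blocks. -/
lemma isTimeInvariant_iff {A : Op k l} :
    IsTimeInvariant A ↔ ∀ x, A (shift 1 x) = shift 1 (A x) := by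
  constructor
  · intro h x
    have : A ∘L shift 1 = shift 1 ∘L A := by
      refine op_ext fun j b => lp.ext (funext fun i => PiLp.ext fun a => ?_)
      have h' := congrFun (congrFun (h (i - 1) j) a) b
      rw [sub_add_cancel] at h'
      simpa only [ContinuousLinearMap.comp_apply, shift_impulse, shift_apply, blocks_apply] using h'
    exact congrArg (fun B : Op k l => B x) this
  · intro h i j
    ext a b
    rw [blocks_apply, blocks_apply, ← shift_impulse, h, shift_apply, add_sub_cancel_right]

lemma IsTimeInvariant.apply_shift_neg {A : Op k l} (h : IsTimeInvariant A) (x : Sig k) :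
    A (shift (-1) x) = shift (-1) (A x) := by
  conv_rhs => rw [← shift_shift_neg 1 x, isTimeInvariant_iff.1 h, shift_neg_shift]

lemma IsTimeInvariant.add {A B : Op k l} (hA : IsTimeInvariant A) (hB : IsTimeInvariant B) :
    IsTimeInvariant (A + B) := fun i j => congrArg₂ (· + ·) (hA i j) (hB i j)

lemma IsTimeInvariant.sub {A B : Op k l} (hA : IsTimeInvariant A) (hB : IsTimeInvariant B) :
    IsTimeInvariant (A - B) := fun i j => congrArg₂ (· - ·) (hA i j) (hB i j)

lemma IsTimeInvariant.neg {A : Op k l} (hA : IsTimeInvariant A) : IsTimeInvariant (-A) :=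
  fun i j => congrArg Neg.neg (hA i j)

lemma IsTimeInvariant.smul {A : Op k l} (hA : IsTimeInvariant A) (c : ℝ) :
    IsTimeInvariant (c • A) := fun i j => congrArg (c • ·) (hA i j)

lemma IsTimeInvariant.comp {A : Op l r} {B : Op k l} (hA : IsTimeInvariant A)
    (hB : IsTimeInvariant B) : IsTimeInvariant (A ∘L B) := by
  rw [isTimeInvariant_iff] at *
  intro x
  simp [hA, hB]

lemma isTimeInvariant_one : IsTimeInvariant (1 : Op k k) :=
  isTimeInvariant_iff.2 fun _ => rfl

lemma IsTimeInvariant.adj {A : Op k l} (hA : IsTimeInvariant A) : IsTimeInvariant (adj A) := by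
  rw [isTimeInvariant_iff]
  intro x
  refine ext_inner_right ℝ fun y => ?_
  rw [ContinuousLinearMap.adjoint_inner_left, inner_shift_left, inner_shift_left,
    ContinuousLinearMap.adjoint_inner_left, hA.apply_shift_neg]

lemma IsTimeInvariant.inverse {A : Op k k} (hA : IsTimeInvariant A) :
    IsTimeInvariant (Ring.inverse A) := by
  by_cases h : IsUnit A
  · rw [isTimeInvariant_iff] at *
    intro x
    have h1 : Ring.inverse A * A = 1 := Ring.inverse_mul_cancel A h
    have h2 : A * Ring.inverse A = 1 := Ring.mul_inverse_cancel A h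
    have h1' : ∀ y, Ring.inverse A (A y) = y := fun y => congrArg (fun B : Op k k => B y) h1
    have h2' : ∀ y, A (Ring.inverse A y) = y := fun y => congrArg (fun B : Op k k => B y) h2
    conv_lhs => rw [← h2' x, ← hA, h1']
  · rw [Ring.inverse_non_unit A h]
    exact fun i j => rfl

lemma IsTimeInvariant.blocks_eq {A : Op k l} (hA : IsTimeInvariant A) (i j s : ℤ) :
    blocks A (i + s) (j + s) = blocks A i j := by
  induction s using Int.induction_on with
  | zero => simp
  | succ s ih => rw [← ih, ← hA (i + s), add_assoc, add_assoc]
  | pred s ih =>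
    rw [← ih, ← hA (i + (-s - 1)), show i + (-(s : ℤ) - 1) + 1 = i + -s by ring,
      show j + (-(s : ℤ) - 1) + 1 = j + -s by ring]

/-- This form makes causality visibly stable under composition. -/
lemma isCausal_iff {A : Op k l} :
    IsCausal A ↔ ∀ (x : Sig k) (t : ℤ), (∀ s < t, x s = 0) → ∀ s < t, A x s = 0 := by
  constructor
  · intro h x t hx s hs
    -- By continuity the output at time `s` is the sum of the responses to the single-time pieces of
    -- `x`. Pieces before `t` are zero, and later ones meet a zero block of `A`.
    have h1 : HasSum (fun j => A (lp.single 2 j (x j)) s) (A x s) :=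
      ((lp.evalCLM ℝ (fun _ : ℤ => EuclideanSpace ℝ (Fin l)) 2 s) ∘L A).hasSum
        (lp.hasSum_single (by simp) x)
    refine h1.unique ?_
    convert hasSum_zero using 2 with j
    rcases lt_or_ge j t with hj | hj
    · rw [hx j hj, lp.single_zero, map_zero]; rfl
    · have h2 : (lp.evalCLM ℝ (fun _ : ℤ => EuclideanSpace ℝ (Fin l)) 2 s) ∘L A ∘L
          lp.singleContinuousLinearMap ℝ (fun _ : ℤ => EuclideanSpace ℝ (Fin k)) 2 j = 0 := by
        refine ContinuousLinearMap.coe_injective ?_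
        refine (EuclideanSpace.basisFun (Fin k) ℝ).toBasis.ext fun b => PiLp.ext fun a => ?_
        have := congrFun (congrFun (h s j (hs.trans_le hj)) a) b
        simp only [OrthonormalBasis.coe_toBasis, EuclideanSpace.basisFun_apply]
        exact this
      exact congrArg (fun B : EuclideanSpace ℝ (Fin k) →L[ℝ] EuclideanSpace ℝ (Fin l) => B (x j)) h2
  · intro h i j hij
    ext a b
    rw [blocks_apply, h (impulse j b) j _ i hij]
    · rfl
    · intro s hs
      exact lp.single_apply_ne _ _ _ hs.ne

lemma IsCausal.comp {A : Op l r} {B : Op k l} (hA : IsCausal A) (hB : IsCausal B) :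
    IsCausal (A ∘L B) := by
  rw [isCausal_iff] at *
  exact fun x t hx => hA (B x) t (hB x t hx)

end Basic

/-! ### Weak compactness of bounded sets of operators -/

section WeakLimit

open Filter Topology

/-- Bounded sequences of operators between Hilbert spaces converge weakly along ultrafilters. -/
lemma exists_weak_limit {E F : Type*} [NormedAddCommGroup E] [InnerProductSpace ℝ E]
    [NormedAddCommGroup F] [InnerProductSpace ℝ F] [CompleteSpace F]
    (A : ℕ → E →L[ℝ] F) (c : ℝ) (hA : ∀ n, ‖A n‖ ≤ c) (u : Ultrafilter ℕ) :
    ∃ B : E →L[ℝ] F, ∀ x y,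
      Tendsto (fun n => inner ℝ (A n x) y) u (𝓝 (inner ℝ (B x) y)) := by
  have bound : ∀ n x y, |inner ℝ (A n x) y| ≤ c * ‖x‖ * ‖y‖ := fun n x y =>
    (abs_real_inner_le_norm _ _).trans
      (mul_le_mul_of_nonneg_right ((A n).le_of_opNorm_le (hA n) x) (norm_nonneg y))
  have lim : ∀ x y, ∃ a, |a| ≤ c * ‖x‖ * ‖y‖ ∧
      Tendsto (fun n => inner ℝ (A n x) y) u (𝓝 a) := by
    intro x y
    obtain ⟨a, ha, hl⟩ := (isCompact_Icc (a := -(c * ‖x‖ * ‖y‖)) (b := c * ‖x‖ * ‖y‖)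
      ).ultrafilter_le_nhds' (u.map fun n => inner ℝ (A n x) y)
      (Filter.mem_map.2 (Filter.univ_mem' fun n => abs_le.1 (bound n x y)))
    exact ⟨a, abs_le.2 ha, hl⟩
  choose f hf hlim using lim
  -- The pointwise limits form a bounded bilinear form, which the Riesz representation turns into an
  -- operator.
  let Φ : E →L[ℝ] F →L[ℝ] ℝ := LinearMap.mkContinuous₂
    (LinearMap.mk₂ ℝ f
      (fun x x' y => tendsto_nhds_unique (hlim _ _) (by
        simpa [inner_add_left] using (hlim x y).add (hlim x' y)))
      (fun a x y => tendsto_nhds_unique (hlim _ _) (by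
        simpa [real_inner_smul_left] using (hlim x y).const_mul a))
      (fun x y y' => tendsto_nhds_unique (hlim _ _) (by
        simpa [inner_add_right] using (hlim x y).add (hlim x y')))
      (fun a x y => tendsto_nhds_unique (hlim _ _) (by
        simpa [real_inner_smul_right] using (hlim x y).const_mul a))) c
    (fun x y => hf x y)
  refine ⟨(InnerProductSpace.toDual ℝ F).symm.toContinuousLinearEquiv.toContinuousLinearMap ∘L Φ,
    fun x y => ?_⟩
  have : inner ℝ ((InnerProductSpace.toDual ℝ F).symm (Φ x)) y = f x y := by
    rw [InnerProductSpace.toDual_symm_apply]; rfl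
  exact (hlim x y).trans (by rw [← this]; rfl)

variable {k l : ℕ} {A : ℕ → Op k l} {B : Op k l} {u : Ultrafilter ℕ}

lemma tendsto_blocks
    (h : ∀ x y, Tendsto (fun n => inner ℝ (A n x) y) u (𝓝 (inner ℝ (B x) y)))
    (i j : ℤ) (a : Fin l) (b : Fin k) :
    Tendsto (fun n => blocks (A n) i j a b) u (𝓝 (blocks B i j a b)) := by
  have h' := h (impulse j b) (impulse i a)
  simp only [real_inner_comm, inner_impulse_left] at h'
  exact h'

lemma isTimeInvariant_of_weak_limit
    (h : ∀ x y, Tendsto (fun n => inner ℝ (A n x) y) u (𝓝 (inner ℝ (B x) y)))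
    (hA : ∀ n, IsTimeInvariant (A n)) : IsTimeInvariant B := by
  intro i j
  ext a b
  refine tendsto_nhds_unique (tendsto_blocks h _ _ a b) ?_
  simpa only [hA _ i j] using tendsto_blocks h i j a b

lemma blocks_eq_of_weak_limit
    (h : ∀ x y, Tendsto (fun n => inner ℝ (A n x) y) u (𝓝 (inner ℝ (B x) y)))
    {i j : ℤ} {Z : Matrix (Fin l) (Fin k) ℝ} (hA : ∀ n, blocks (A n) i j = Z) :
    blocks B i j = Z := by
  ext a b
  refine tendsto_nhds_unique (tendsto_blocks h _ _ a b) ?_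
  simp only [hA, tendsto_const_nhds_iff]

/-- Testing against `B x` itself gives `‖B x‖² = lim ⟨A n x, B x⟩ ≤ c₀ ‖x‖ ‖B x‖`. -/
lemma norm_le_of_weak_limit
    (h : ∀ x y, Tendsto (fun n => inner ℝ (A n x) y) u (𝓝 (inner ℝ (B x) y)))
    {c : ℕ → ℝ} {c₀ : ℝ} (hc₀ : 0 ≤ c₀) (hc : Tendsto c u (𝓝 c₀)) (hA : ∀ n, ‖A n‖ ≤ c n) :
    ‖B‖ ≤ c₀ := by
  refine B.opNorm_le_bound hc₀ fun x => ?_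
  have h1 : ‖B x‖ * ‖B x‖ ≤ c₀ * ‖x‖ * ‖B x‖ := by
    rw [← real_inner_self_eq_norm_mul_norm]
    refine le_of_tendsto_of_tendsto (h x (B x)) ((hc.mul_const ‖x‖).mul_const ‖B x‖)
      (Filter.Eventually.of_forall fun n => ?_)
    exact (real_inner_le_norm _ _).trans
      (mul_le_mul_of_nonneg_right ((A n).le_of_opNorm_le (hA n) x) (norm_nonneg _))
  rcases (norm_nonneg (B x)).eq_or_lt with h0 | h0
  · rw [← h0]; positivity
  · exact le_of_mul_le_mul_right h1 h0

end WeakLimit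

/-- The left side is affine in `x` and equals `‖y‖²` at `x = y`, so taking `y` to be a weak limit
yields lower semicontinuity of the squared norm. -/
lemma two_mul_inner_sub_le_norm_sq {F : Type*} [NormedAddCommGroup F] [InnerProductSpace ℝ F]
    (x y : F) : 2 * inner ℝ x y - ‖y‖ ^ 2 ≤ ‖x‖ ^ 2 := by
  have := sq_nonneg ‖x - y‖
  rw [norm_sub_sq_real] at this
  linarith

/-! ### The Frobenius inner product per time step -/

section FrobeniusNorm

variable {k l r : ℕ}

lemma adj_comp (A : Op l r) (B : Op k l) : adj (A ∘L B) = adj B ∘L adj A :=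
  ContinuousLinearMap.adjoint_comp A B

lemma adj_adj (A : Op k l) : adj (adj A) = A := ContinuousLinearMap.adjoint_adjoint A

/-- The inner product per time step of the Frobenius norm. -/
def frob (U V : Op k l) : ℝ := ∑ b, inner ℝ (U (impulse 0 b)) (V (impulse 0 b))

lemma frob_add_right (U V V' : Op k l) : frob U (V + V') = frob U V + frob U V' := by
  simp [frob, inner_add_right, Finset.sum_add_distrib]

lemma frob_add_left (U U' V : Op k l) : frob (U + U') V = frob U V + frob U' V := by
  simp [frob, inner_add_left, Finset.sum_add_distrib]

lemma frob_comm (U V : Op k l) : frob U V = frob V U := by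
  simp [frob, real_inner_comm]

lemma frob_self (U : Op k l) : frob U U = ∑ b, ‖U (impulse 0 b)‖ ^ 2 := by
  simp [frob]

lemma frob_self_nonneg (U : Op k l) : 0 ≤ frob U U := by
  rw [frob_self]; positivity

/-- A time-invariant operator is determined by its block column at time `0`. -/
lemma frob_self_pos {U : Op k l} (hU : IsTimeInvariant U) (h : U ≠ 0) : 0 < frob U U := by
  refine (frob_self_nonneg U).lt_of_ne fun h0 => h ?_
  rw [frob_self, eq_comm, Finset.sum_eq_zero_iff_of_nonneg (fun _ _ => by positivity)] at h0
  refine blocks_injective ?_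
  funext i j
  have := hU.blocks_eq (i - j) 0 j
  rw [sub_add_cancel, zero_add] at this
  rw [this]
  ext a b
  have hb : U (impulse 0 b) = 0 := by simpa using h0 b (Finset.mem_univ b)
  rw [blocks_apply, hb]
  rfl

lemma frob_comp_left (L : Op l r) (U : Op k l) (V : Op k r) :
    frob (L ∘L U) V = frob U (adj L ∘L V) := by
  simp [frob, ContinuousLinearMap.adjoint_inner_right]

lemma frob_eq_tsum (U V : Op k l) :
    frob U V = ∑' i, ∑ b, ∑ a, blocks U i 0 a b * blocks V i 0 a b := by
  have h : ∀ b : Fin k, HasSum (fun i => ∑ a, blocks U i 0 a b * blocks V i 0 a b)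
      (inner ℝ (U (impulse 0 b)) (V (impulse 0 b))) := by
    intro b
    have h1 : (fun i => ∑ a, blocks U i 0 a b * blocks V i 0 a b) =
        fun i => inner ℝ (U (impulse 0 b) i) (V (impulse 0 b) i) := by
      funext i
      rw [PiLp.inner_apply]
      exact Finset.sum_congr rfl fun a _ => mul_comm _ _
    rw [h1]
    exact lp.hasSum_inner (𝕜 := ℝ) _ _
  exact (hasSum_sum fun b _ => h b).tsum_eq.symm

/-- By the Toeplitz property, column `0` of the adjoint lists the transposed blocks of column `0`
with time reversed, which explains the reindexing `i ↦ -i`. -/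
lemma frob_adj {U V : Op k l} (hU : IsTimeInvariant U) (hV : IsTimeInvariant V) :
    frob (adj U) (adj V) = frob U V := by
  rw [frob_eq_tsum, frob_eq_tsum, ← (Equiv.neg ℤ).tsum_eq]
  refine tsum_congr fun i => ?_
  rw [Finset.sum_comm]
  refine Finset.sum_congr rfl fun b _ => Finset.sum_congr rfl fun a _ => ?_
  have h1 := hU.blocks_eq 0 (-i) i
  have h2 := hV.blocks_eq 0 (-i) i
  rw [zero_add, neg_add_cancel] at h1 h2
  rw [blocks_adj, blocks_adj, Equiv.neg_apply, ← h1, ← h2]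

/-- This replaces cyclicity of the trace: taking adjoints turns the right factor into a left one,
which moves across the inner product. -/
lemma frob_comp_right {U : Op l r} {R : Op k l} {V : Op k r} (hU : IsTimeInvariant U)
    (hR : IsTimeInvariant R) (hV : IsTimeInvariant V) :
    frob (U ∘L R) V = frob U (V ∘L adj R) := by
  rw [← frob_adj (hU.comp hR) hV, ← frob_adj hU (hV.comp hR.adj),
    adj_comp, adj_comp, adj_adj, frob_comp_left, adj_adj]

end FrobeniusNorm

/-! ### Invertibility and canonical factors -/

section Inverse

variable {k l : ℕ}

/-- The operator is coercive with constant one, so Lax–Milgram applies. -/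
lemma isUnit_one_add {N : Op k k} (h : ∀ x, 0 ≤ inner ℝ (N x) x) : IsUnit (1 + N) := by
  refine ContinuousLinearMap.isUnit_of_forall_le_norm_inner_map _ (c := 1) one_pos fun x => ?_
  have h1 : inner ℝ ((1 + N) x) x = ‖x‖ ^ 2 + inner ℝ (N x) x := by
    rw [add_apply, inner_add_left, one_apply_eq_self, real_inner_self_eq_norm_sq]
  rw [h1, NNReal.coe_one, mul_one]
  exact (le_add_of_nonneg_right (h x)).trans (Real.le_norm_self _)

lemma isUnit_one_add_adj_comp (A : Op k l) : IsUnit (1 + adj A ∘L A) :=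
  isUnit_one_add fun x => by
    rw [ContinuousLinearMap.comp_apply, ContinuousLinearMap.adjoint_inner_left]
    exact real_inner_self_nonneg

lemma isUnit_one_add_comp_adj (A : Op k l) : IsUnit (1 + A ∘L adj A) := by
  simpa using isUnit_one_add_adj_comp (adj A)

lemma isUnit_adj {A : Op k k} (h : IsUnit A) : IsUnit (adj A) := h.star

lemma inverse_apply_apply {A : Op k k} (h : IsUnit A) (x : Sig k) : Ring.inverse A (A x) = x :=
  congrArg (fun B : Op k k => B x) (Ring.inverse_mul_cancel A h)

lemma apply_inverse_apply {A : Op k k} (h : IsUnit A) (x : Sig k) : A (Ring.inverse A x) = x :=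
  congrArg (fun B : Op k k => B x) (Ring.mul_inverse_cancel A h)

lemma IsCanonicalFactor.isUnit_self {A R : Op k k} (h : IsCanonicalFactor A R) : IsUnit A :=
  h.factor ▸ (isUnit_adj h.isUnit).mul h.isUnit

lemma IsCanonicalFactor.inner_apply {A R : Op k k} (h : IsCanonicalFactor A R) (x y : Sig k) :
    inner ℝ (A x) y = inner ℝ (R x) (R y) := by
  rw [← h.factor, ContinuousLinearMap.comp_apply, ContinuousLinearMap.adjoint_inner_left]

lemma IsCanonicalFactor.inner_apply_sub_smul {A R : Op k k} (h : IsCanonicalFactor A R)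
    (x g : Sig k) (c : ℝ) :
    inner ℝ (A (x - c • g)) (x - c • g) =
      inner ℝ (A x) x - 2 * c * inner ℝ (A g) x + c * c * inner ℝ g (A g) := by
  rw [real_inner_comm (A g) g]
  simp only [h.inner_apply, map_sub, map_smul, inner_sub_left, inner_sub_right,
    real_inner_smul_left, real_inner_smul_right, real_inner_comm (R g) (R x)]
  ring

end Inverse

/-! ### The `H₂`-optimal non-causal controller -/

namespace Plant

variable {n m p q : ℕ} (P : Plant n m p q)

lemma isUnit_opT : IsUnit P.opT := isUnit_one_add_adj_comp _

lemma isTimeInvariant_opT : IsTimeInvariant P.opT :=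
  isTimeInvariant_one.add (P.timeInvariant₁₂.adj.comp P.timeInvariant₁₂)

lemma isTimeInvariant_Q₂ : IsTimeInvariant P.Q₂ :=
  (P.isTimeInvariant_opT.inverse.comp (P.timeInvariant₁₂.adj.comp (P.timeInvariant₁₁.comp
    (P.timeInvariant₂₁.adj.comp (isTimeInvariant_one.add
      (P.timeInvariant₂₁.comp P.timeInvariant₂₁.adj)).inverse)))).neg

lemma opT_Q₂_apply (y : Sig p) :
    P.opT (P.Q₂ y) = -(adj P.P₁₂ (P.P₁₁ (adj P.P₂₁
      (Ring.inverse (1 + P.P₂₁ ∘L adj P.P₂₁) y)))) := by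
  rw [Q₂, neg_apply, map_neg]
  exact congrArg Neg.neg (apply_inverse_apply P.isUnit_opT _)

lemma h2Cost_eq (Q : Op p m) :
    P.h2Cost Q = frob (P.P₁₁ + P.P₁₂ ∘L Q ∘L P.P₂₁) (P.P₁₁ + P.P₁₂ ∘L Q ∘L P.P₂₁) +
      frob (Q ∘L P.P₂₁) (Q ∘L P.P₂₁) + (frob (P.P₁₂ ∘L Q) (P.P₁₂ ∘L Q) + frob Q Q) := by
  simp [h2Cost, cost, regulated, control, frob_self, Finset.sum_add_distrib]

/-- Expanded form of `T Q₂ (I + P₂₁ P₂₁*) + P₁₂* P₁₁ P₂₁* = 0`, the stationarity condition of the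
`H₂` cost. -/
lemma normal_equation :
    adj P.P₁₂ ∘L (P.P₁₁ + P.P₁₂ ∘L P.Q₂ ∘L P.P₂₁) ∘L adj P.P₂₁ + P.Q₂ ∘L P.P₂₁ ∘L adj P.P₂₁ +
      adj P.P₁₂ ∘L P.P₁₂ ∘L P.Q₂ + P.Q₂ = 0 := by
  have hS := isUnit_one_add_comp_adj P.P₂₁
  have h : ∀ z, P.Q₂ (z + P.P₂₁ (adj P.P₂₁ z)) +
      adj P.P₁₂ (P.P₁₂ (P.Q₂ (z + P.P₂₁ (adj P.P₂₁ z)))) +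
      adj P.P₁₂ (P.P₁₁ (adj P.P₂₁ z)) = 0 := by
    intro z
    have h1 := P.opT_Q₂_apply ((1 + P.P₂₁ ∘L adj P.P₂₁) z)
    rw [inverse_apply_apply hS, eq_neg_iff_add_eq_zero] at h1
    exact h1
  refine ContinuousLinearMap.ext fun z => ?_
  rw [zero_apply, ← h z]
  simp only [add_apply, ContinuousLinearMap.comp_apply, map_add]
  abel

/-- The linear term in `D = Q - Q₂` vanishes by the normal equation, and the quadratic term contains
`frob D D > 0`. -/
lemma h2Cost_Q₂_lt {Q : Op p m} (hQ : IsTimeInvariant Q) (hne : Q ≠ P.Q₂) :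
    P.h2Cost P.Q₂ < P.h2Cost Q := by
  obtain ⟨D, rfl⟩ : ∃ D, Q = P.Q₂ + D := ⟨Q - P.Q₂, by abel⟩
  have hD : IsTimeInvariant D := by simpa using hQ.sub P.isTimeInvariant_Q₂
  have hD0 : D ≠ 0 := by simpa using hne
  have hQ₂ := P.isTimeInvariant_Q₂
  have hA := P.timeInvariant₂₁
  have hG := P.timeInvariant₁₂
  have hH := P.timeInvariant₁₁
  have hpos := frob_self_pos hD hD0
  have h1 := frob_self_nonneg (P.P₁₂ ∘L D ∘L P.P₂₁)
  have h2 := frob_self_nonneg (D ∘L P.P₂₁)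
  have h3 := frob_self_nonneg (P.P₁₂ ∘L D)
  -- This is half the derivative of the cost at `Q₂` in the direction `D`.
  have c0 : frob D (adj P.P₁₂ ∘L (P.P₁₁ + P.P₁₂ ∘L P.Q₂ ∘L P.P₂₁) ∘L adj P.P₂₁ +
      P.Q₂ ∘L P.P₂₁ ∘L adj P.P₂₁ + adj P.P₁₂ ∘L P.P₁₂ ∘L P.Q₂ + P.Q₂) = 0 := by
    rw [P.normal_equation]
    simp [frob]
  have c1 : frob (P.P₁₂ ∘L D ∘L P.P₂₁) (P.P₁₁ + P.P₁₂ ∘L P.Q₂ ∘L P.P₂₁) =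
      frob D (adj P.P₁₂ ∘L (P.P₁₁ + P.P₁₂ ∘L P.Q₂ ∘L P.P₂₁) ∘L adj P.P₂₁) := by
    rw [frob_comp_left, frob_comp_right hD hA
      (hG.adj.comp (hH.add (hG.comp (hQ₂.comp hA))))]
    rfl
  have c2 : frob (D ∘L P.P₂₁) (P.Q₂ ∘L P.P₂₁) = frob D (P.Q₂ ∘L P.P₂₁ ∘L adj P.P₂₁) :=
    frob_comp_right hD hA (hQ₂.comp hA)
  have c3 : frob (P.P₁₂ ∘L D) (P.P₁₂ ∘L P.Q₂) = frob D (adj P.P₁₂ ∘L P.P₁₂ ∘L P.Q₂) :=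
    frob_comp_left _ _ _
  have e1 : P.P₁₁ + P.P₁₂ ∘L (P.Q₂ + D) ∘L P.P₂₁ =
      (P.P₁₁ + P.P₁₂ ∘L P.Q₂ ∘L P.P₂₁) + P.P₁₂ ∘L D ∘L P.P₂₁ := by
    ext1 x; simp [add_assoc]
  have e2 : (P.Q₂ + D) ∘L P.P₂₁ = P.Q₂ ∘L P.P₂₁ + D ∘L P.P₂₁ := ContinuousLinearMap.add_comp _ _ _
  have e3 : P.P₁₂ ∘L (P.Q₂ + D) = P.P₁₂ ∘L P.Q₂ + P.P₁₂ ∘L D := ContinuousLinearMap.comp_add _ _ _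
  have sq : ∀ {k l : ℕ} (U V : Op k l),
      frob (U + V) (U + V) = frob U U + 2 * frob V U + frob V V := by
    intro k l U V
    rw [frob_add_left, frob_add_right, frob_add_right, frob_comm U V]
    ring
  rw [frob_add_right, frob_add_right, frob_add_right] at c0
  rw [h2Cost_eq, h2Cost_eq, e1, e2, e3, sq (_ + _) (_ ∘L _ ∘L _),
    sq (P.Q₂ ∘L _), sq (_ ∘L P.Q₂), sq P.Q₂, c1, c2, c3]
  linarith

/-! ### The regret as a quadratic form -/

lemma worstRegret_le_iff (Q₀ Q : Op p m) (c : ℝ) :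
    P.worstRegret Q₀ Q ≤ (c : EReal) ↔
      ∀ w v, P.regret Q₀ Q w v ≤ c * (‖w‖ ^ 2 + ‖v‖ ^ 2) := by
  simp only [worstRegret, iSup_le_iff, EReal.coe_le_coe_iff]
  refine forall₂_congr fun w v => ?_
  by_cases h : w = 0 ∧ v = 0
  · obtain ⟨rfl, rfl⟩ := h
    simp [regret, cost, regulated, control]
  · have : 0 < ‖w‖ ^ 2 + ‖v‖ ^ 2 := by
      rcases not_and_or.1 h with h | h <;> have := norm_pos_iff.2 h <;> positivity
    simp [h, div_le_iff₀ this]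

lemma regulated_eq (Q : Op p m) (w : Sig n) (v : Sig p) :
    P.regulated Q w v = P.P₁₁ w + P.P₁₂ (Q (P.P₂₁ w + v)) := by
  simp [regulated, add_assoc]

lemma control_eq (Q : Op p m) (w : Sig n) (v : Sig p) :
    P.control Q w v = Q (P.P₂₁ w + v) := by
  simp [control]

lemma inner_opT (x y : Sig m) :
    inner ℝ (P.opT x) y = inner ℝ x y + inner ℝ (P.P₁₂ x) (P.P₁₂ y) := by
  rw [opT, add_apply, inner_add_left, ContinuousLinearMap.comp_apply,
    ContinuousLinearMap.adjoint_inner_left, one_apply_eq_self]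

lemma inner_opM_self (γ : ℝ) (x : Sig m) :
    inner ℝ (P.opM γ x) x = (γ ^ 2)⁻¹ * (‖x‖ ^ 2 + ‖P.P₁₂ x‖ ^ 2 + (γ ^ 2)⁻¹ *
      inner ℝ (Ring.inverse (1 + adj P.P₂₁ ∘L P.P₂₁) (adj P.P₁₁ (P.P₁₂ x)))
        (adj P.P₁₁ (P.P₁₂ x))) := by
  simp only [opM, add_apply, smul_apply, inner_add_left, ContinuousLinearMap.comp_apply,
    real_inner_smul_left, one_apply_eq_self, ContinuousLinearMap.adjoint_inner_left,
    ContinuousLinearMap.adjoint_inner_right, real_inner_self_eq_norm_sq]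
  ring

lemma inner_opW_self (Q₀ : Op p m) (γ : ℝ) (y : Sig p) :
    inner ℝ (P.opW Q₀ γ y) y = inner ℝ (Ring.inverse (1 + P.P₂₁ ∘L adj P.P₂₁) y) y +
      (γ ^ 4)⁻¹ * inner ℝ (Ring.inverse (P.opM γ) (P.opT (P.Q₂ y - Q₀ y)))
        (P.opT (P.Q₂ y - Q₀ y)) := by
  simp only [opW, add_apply, smul_apply, inner_add_left, ContinuousLinearMap.comp_apply,
    real_inner_smul_left, ContinuousLinearMap.adjoint_inner_left, sub_apply, inner_opT]
  rw [real_inner_comm (P.opT _), inner_opT, real_inner_comm (P.Q₂ y - Q₀ y),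
    real_inner_comm (P.P₁₂ (P.Q₂ y - Q₀ y))]

/-- Completion of squares of the regret, first over the disturbances that produce the measurement
`y` and then over the control. -/
lemma completed_squares (Q₀ Q : Op p m) {γ : ℝ} (hγ : 0 < γ) {Mh : Op m m}
    (hM : IsCanonicalFactor (P.opM γ) Mh) (y : Sig p) (w' : Sig n) :
    let S' := Ring.inverse (1 + P.P₂₁ ∘L adj P.P₂₁)
    let N' := Ring.inverse (1 + adj P.P₂₁ ∘L P.P₂₁)
    let z := Q y - Q₀ y - (γ ^ 2)⁻¹ • Ring.inverse (P.opM γ) (P.opT (P.Q₂ y - Q₀ y))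
    let e := w' - (γ ^ 2)⁻¹ • N' (adj P.P₁₁ (P.P₁₂ (Q y - Q₀ y)))
    γ ^ 2 * (‖adj P.P₂₁ (S' y) + w'‖ ^ 2 + ‖S' y - P.P₂₁ w'‖ ^ 2) -
        P.regret Q₀ Q (adj P.P₂₁ (S' y) + w') (S' y - P.P₂₁ w') =
      γ ^ 2 * (‖e‖ ^ 2 + ‖P.P₂₁ e‖ ^ 2) +
        γ ^ 2 * (inner ℝ (P.opW Q₀ γ y) y - inner ℝ (P.opM γ z) z) := by
  intro S' N' z e
  have htc : γ ^ 2 * (γ ^ 2)⁻¹ = 1 := mul_inv_cancel₀ (by positivity)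
  have hγ4 : (γ ^ 4)⁻¹ = (γ ^ 2)⁻¹ * (γ ^ 2)⁻¹ := by rw [← mul_inv]; ring
  have hp : S' y + P.P₂₁ (adj P.P₂₁ (S' y)) = y :=
    apply_inverse_apply (isUnit_one_add_comp_adj P.P₂₁) y
  have hT := P.opT_Q₂_apply y
  have hMs := P.inner_opM_self γ (Q y - Q₀ y)
  have hWs := P.inner_opW_self Q₀ γ y
  have hf : N' (adj P.P₁₁ (P.P₁₂ (Q y - Q₀ y))) +
      adj P.P₂₁ (P.P₂₁ (N' (adj P.P₁₁ (P.P₁₂ (Q y - Q₀ y))))) =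
        adj P.P₁₁ (P.P₁₂ (Q y - Q₀ y)) :=
    apply_inverse_apply (isUnit_one_add_adj_comp P.P₂₁) _
  have hg := apply_inverse_apply hM.isUnit_self (P.opT (P.Q₂ y - Q₀ y))
  have hMz : inner ℝ (P.opM γ z) z = inner ℝ (P.opM γ (Q y - Q₀ y)) (Q y - Q₀ y) -
      2 * (γ ^ 2)⁻¹ * inner ℝ (P.opT (P.Q₂ y - Q₀ y)) (Q y - Q₀ y) + (γ ^ 2)⁻¹ * (γ ^ 2)⁻¹ *
        inner ℝ (Ring.inverse (P.opM γ) (P.opT (P.Q₂ y - Q₀ y))) (P.opT (P.Q₂ y - Q₀ y)) := by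
    rw [hM.inner_apply_sub_smul, hg]
  change inner ℝ (P.opW Q₀ γ y) y = inner ℝ (S' y) y + _ at hWs
  change P.opT (P.Q₂ y) = -(adj P.P₁₂ (P.P₁₁ (adj P.P₂₁ (S' y)))) at hT
  change inner ℝ (P.opM γ (Q y - Q₀ y)) (Q y - Q₀ y) =
    (γ ^ 2)⁻¹ * (‖Q y - Q₀ y‖ ^ 2 + ‖P.P₁₂ (Q y - Q₀ y)‖ ^ 2 + (γ ^ 2)⁻¹ *
      inner ℝ (N' (adj P.P₁₁ (P.P₁₂ (Q y - Q₀ y)))) (adj P.P₁₁ (P.P₁₂ (Q y - Q₀ y)))) at hMs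
  have hy : P.P₂₁ (adj P.P₂₁ (S' y) + w') + (S' y - P.P₂₁ w') = y := by
    rw [map_add]
    conv_rhs => rw [← hp]
    abel
  -- The cross term is rewritten in the inner product `⟨·,·⟩ + ⟨P₂₁ ·, P₂₁ ·⟩`, in which the square
  -- in `w'` is completed.
  have hcross : inner ℝ (P.P₁₁ w') (P.P₁₂ (Q y - Q₀ y)) =
      inner ℝ w' (N' (adj P.P₁₁ (P.P₁₂ (Q y - Q₀ y)))) +
        inner ℝ (P.P₂₁ w') (P.P₂₁ (N' (adj P.P₁₁ (P.P₁₂ (Q y - Q₀ y))))) := by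
    rw [← ContinuousLinearMap.adjoint_inner_right, ← hf, inner_add_right,
      ContinuousLinearMap.adjoint_inner_right, hf]
  have hff : inner ℝ (N' (adj P.P₁₁ (P.P₁₂ (Q y - Q₀ y)))) (adj P.P₁₁ (P.P₁₂ (Q y - Q₀ y))) =
      ‖N' (adj P.P₁₁ (P.P₁₂ (Q y - Q₀ y)))‖ ^ 2 +
        ‖P.P₂₁ (N' (adj P.P₁₁ (P.P₁₂ (Q y - Q₀ y))))‖ ^ 2 := by
    nth_rewrite 2 [← hf]
    rw [inner_add_right, ContinuousLinearMap.adjoint_inner_right, real_inner_self_eq_norm_sq,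
      real_inner_self_eq_norm_sq]
  have hpy : inner ℝ (S' y) y = ‖S' y‖ ^ 2 + ‖adj P.P₂₁ (S' y)‖ ^ 2 := by
    nth_rewrite 2 [← hp]
    rw [inner_add_right, ← ContinuousLinearMap.adjoint_inner_left P.P₂₁, real_inner_self_eq_norm_sq,
      real_inner_self_eq_norm_sq]
  have hTd : inner ℝ (P.opT (P.Q₂ y - Q₀ y)) (Q y - Q₀ y) =
      -(inner ℝ (P.P₁₁ (adj P.P₂₁ (S' y))) (P.P₁₂ (Q y - Q₀ y)) +
        inner ℝ (Q₀ y) (Q y - Q₀ y) + inner ℝ (P.P₁₂ (Q₀ y)) (P.P₁₂ (Q y - Q₀ y))) := by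
    rw [map_sub, hT, inner_sub_left, inner_neg_left, ContinuousLinearMap.adjoint_inner_left,
      inner_opT]
    ring
  -- Both controllers see the same `y`, so the regret is quadratic in `Q y - Q₀ y`, and `w'` enters
  -- only through one cross term.
  have hreg : P.regret Q₀ Q (adj P.P₂₁ (S' y) + w') (S' y - P.P₂₁ w') =
      ‖Q y - Q₀ y‖ ^ 2 + ‖P.P₁₂ (Q y - Q₀ y)‖ ^ 2 -
        2 * inner ℝ (P.opT (P.Q₂ y - Q₀ y)) (Q y - Q₀ y) +
        2 * inner ℝ (P.P₁₁ w') (P.P₁₂ (Q y - Q₀ y)) := by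
    rw [regret, cost, cost, regulated_eq, control_eq, regulated_eq, control_eq, hy, hTd]
    have e1 : P.P₁₂ (Q y) = P.P₁₂ (Q₀ y) + P.P₁₂ (Q y - Q₀ y) := by rw [← map_add]; congr 1; abel
    have e2 : ‖Q y‖ ^ 2 = ‖Q₀ y‖ ^ 2 + 2 * inner ℝ (Q₀ y) (Q y - Q₀ y) + ‖Q y - Q₀ y‖ ^ 2 := by
      rw [← norm_add_sq_real, add_sub_cancel]
    rw [e1, ← add_assoc, norm_add_sq_real (_ + _), map_add, inner_add_left, inner_add_left]
    rw [e2]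
    ring
  -- The least-norm pair producing `y` is orthogonal to the pairs `(w', -P₂₁ w')` with zero
  -- measurement.
  have hsq : ‖adj P.P₂₁ (S' y) + w'‖ ^ 2 + ‖S' y - P.P₂₁ w'‖ ^ 2 =
      ‖S' y‖ ^ 2 + ‖adj P.P₂₁ (S' y)‖ ^ 2 + ‖w'‖ ^ 2 + ‖P.P₂₁ w'‖ ^ 2 := by
    rw [norm_add_sq_real, norm_sub_sq_real, ContinuousLinearMap.adjoint_inner_left]
    ring
  have he : ‖e‖ ^ 2 + ‖P.P₂₁ e‖ ^ 2 = ‖w'‖ ^ 2 + ‖P.P₂₁ w'‖ ^ 2 -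
      2 * (γ ^ 2)⁻¹ * inner ℝ (P.P₁₁ w') (P.P₁₂ (Q y - Q₀ y)) + (γ ^ 2)⁻¹ * (γ ^ 2)⁻¹ *
        (‖N' (adj P.P₁₁ (P.P₁₂ (Q y - Q₀ y)))‖ ^ 2 +
        ‖P.P₂₁ (N' (adj P.P₁₁ (P.P₁₂ (Q y - Q₀ y))))‖ ^ 2) := by
    rw [hcross]
    simp only [e, map_sub P.P₂₁, map_smul, norm_sub_sq_real w', norm_sub_sq_real (P.P₂₁ w'),
      real_inner_smul_right, norm_smul, mul_pow, Real.norm_eq_abs, sq_abs]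
    ring
  rw [hsq, hreg, he, hMz, hWs, hMs, hpy, hff, hγ4]
  generalize inner ℝ (P.opT (P.Q₂ y - Q₀ y)) (Q y - Q₀ y) = τ
  generalize inner ℝ (P.P₁₁ w') (P.P₁₂ (Q y - Q₀ y)) = σ
  generalize (γ ^ 2)⁻¹ = c at *
  linear_combination (2 * σ - 2 * τ + ‖Q y - Q₀ y‖ ^ 2 + ‖P.P₁₂ (Q y - Q₀ y)‖ ^ 2) * htc

end Plant

/-! ### The Nehari problem and its attainment -/

section Nehari

open Filter Topology

variable {k l : ℕ}

namespace BlockMatrix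

lemma causalPart_add_antiPart (B : BlockMatrix k l) : B.causalPart + B.antiPart = B := by
  funext i j
  by_cases h : j ≤ i
  · simp [causalPart, antiPart, h, not_lt.2 h]
  · simp [causalPart, antiPart, h, not_le.1 h]

lemma isCausal_causalPart (B : BlockMatrix k l) : B.causalPart.IsCausal :=
  fun _ _ h => if_neg (not_le.2 h)

lemma IsToeplitz.causalPart {B : BlockMatrix k l} (h : B.IsToeplitz) : B.causalPart.IsToeplitz := by
  intro i j
  simp [BlockMatrix.causalPart, h i j]

lemma IsToeplitz.antiPart {B : BlockMatrix k l} (h : B.IsToeplitz) : B.antiPart.IsToeplitz := by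
  intro i j
  simp [BlockMatrix.antiPart, h i j]

lemma IsToeplitz.add {B C : BlockMatrix k l} (hB : B.IsToeplitz) (hC : C.IsToeplitz) :
    (B + C).IsToeplitz := fun i j => congrArg₂ (· + ·) (hB i j) (hC i j)

lemma IsToeplitz.sub {B C : BlockMatrix k l} (hB : B.IsToeplitz) (hC : C.IsToeplitz) :
    (B - C).IsToeplitz := fun i j => congrArg₂ (· - ·) (hB i j) (hC i j)

lemma IsCausal.add {B C : BlockMatrix k l} (hB : B.IsCausal) (hC : C.IsCausal) :
    (B + C).IsCausal := fun i j h => by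
  rw [Pi.add_apply, Pi.add_apply, hB i j h, hC i j h, add_zero]

lemma IsCausal.sub {B C : BlockMatrix k l} (hB : B.IsCausal) (hC : C.IsCausal) :
    (B - C).IsCausal := fun i j h => by
  rw [Pi.sub_apply, Pi.sub_apply, hB i j h, hC i j h, sub_zero]

lemma opNorm_blocks (A : Op k l) : (blocks A).opNorm = ‖A‖ₑ :=
  le_antisymm (iInf₂_le (f := fun (B : Op k l) (_ : blocks B = blocks A) => ‖B‖ₑ) A rfl)
    (le_iInf₂ fun _ hB => (blocks_injective hB) ▸ le_rfl)

lemma exists_of_opNorm_lt_top {B : BlockMatrix k l} (h : B.opNorm < ⊤) : ∃ A, blocks A = B := by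
  obtain ⟨A, hA⟩ := iInf_lt_iff.1 h
  obtain ⟨hB, -⟩ := iInf_lt_iff.1 hA
  exact ⟨A, hB⟩

end BlockMatrix

/-- The weak limit is taken of the bounded errors `A = C - Z`, since `C` and `Z` may be unbounded.
Causality of `C` fixes the blocks of `A` above the diagonal to be those of `-Z`, which persists in
the limit. -/
lemma exists_isNehariSolution {Z : BlockMatrix k l} (hZ : Z.IsToeplitz) (h : nehariValue Z ≤ 1) :
    ∃ C, IsNehariSolution Z C := by
  have key : ∀ N : ℕ, ∃ A : Op k l, IsTimeInvariant A ∧ (blocks A + Z).IsCausal ∧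
      ‖A‖ ≤ 1 + 1 / ((N : ℝ) + 1) := by
    intro N
    have hpos : (0 : ℝ) < 1 / ((N : ℝ) + 1) := by positivity
    have h1 : nehariValue Z < ENNReal.ofReal (1 + 1 / ((N : ℝ) + 1)) := by
      refine h.trans_lt ?_
      rw [← ENNReal.ofReal_one]
      exact (ENNReal.ofReal_lt_ofReal_iff (by positivity)).2 (by linarith)
    simp only [nehariValue, iInf_lt_iff] at h1
    obtain ⟨C, hT, hC, hlt⟩ := h1
    obtain ⟨A, hA⟩ := BlockMatrix.exists_of_opNorm_lt_top (hlt.trans ENNReal.ofReal_lt_top)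
    refine ⟨A, ?_, ?_, ?_⟩
    · rw [IsTimeInvariant, hA]; exact hT.sub hZ
    · rwa [hA, sub_add_cancel]
    · rw [← hA, BlockMatrix.opNorm_blocks, ← ofReal_norm] at hlt
      exact ((ENNReal.ofReal_lt_ofReal_iff (by positivity)).1 hlt).le
  choose A hT hC hn using key
  obtain ⟨B, hB⟩ := exists_weak_limit A 2 (fun N => (hn N).trans (by
    have : 1 / ((N : ℝ) + 1) ≤ 1 := (div_le_one (by positivity)).2 (by simp)
    linarith)) (hyperfilter ℕ)
  have hlim : Tendsto (fun N : ℕ => 1 + 1 / ((N : ℝ) + 1)) (hyperfilter ℕ) (𝓝 1) := by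
    simpa using (tendsto_one_div_add_atTop_nhds_zero_nat (𝕜 := ℝ)).const_add 1 |>.mono_left
      Nat.hyperfilter_le_atTop
  refine ⟨blocks B + Z, (show (blocks B).IsToeplitz from
    isTimeInvariant_of_weak_limit hB hT).add hZ, fun i j hij => ?_, ?_⟩
  · have : blocks B i j = -Z i j :=
      blocks_eq_of_weak_limit hB fun N => eq_neg_of_add_eq_zero_left (hC N i j hij)
    rw [Pi.add_apply, Pi.add_apply, this, neg_add_cancel]
  · rw [add_sub_cancel_right, BlockMatrix.opNorm_blocks, ← ofReal_norm,
      ← ENNReal.ofReal_one]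
    exact ENNReal.ofReal_le_ofReal (norm_le_of_weak_limit hB zero_le_one hlim hn)

lemma IsNehariSolution.nehariValue_le {Z C : BlockMatrix k l} (h : IsNehariSolution Z C) :
    nehariValue Z ≤ 1 :=
  (iInf_le_of_le C (iInf₂_le h.toeplitz h.causal)).trans h.opNorm_le

end Nehari

/-! ### From regret to Nehari, and the optimal regret -/

namespace Plant

open Filter Topology

variable {n m p q : ℕ} (P : Plant n m p q)

lemma worstRegret_le_sq_iff (Q₀ Q : Op p m) {γ : ℝ} (hγ : 0 < γ) {Mh : Op m m} {Wh : Op p p}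
    (hM : IsCanonicalFactor (P.opM γ) Mh) (hW : IsCanonicalFactor (P.opW Q₀ γ) Wh) :
    P.worstRegret Q₀ Q ≤ ((γ ^ 2 : ℝ) : EReal) ↔
      ‖Mh ∘L Q ∘L Ring.inverse Wh - P.opX Q₀ γ Mh Wh‖ ≤ 1 := by
  have hz : ∀ y, (Mh ∘L Q ∘L Ring.inverse Wh - P.opX Q₀ γ Mh Wh) (Wh y) =
      Mh (Q y - Q₀ y - (γ ^ 2)⁻¹ • Ring.inverse (P.opM γ) (P.opT (P.Q₂ y - Q₀ y))) := by
    intro y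
    -- This is `M^{-*/2} = M^{1/2} M⁻¹`, a consequence of `M = M^{*/2} M^{1/2}`.
    have h1 : ∀ x, adj (Ring.inverse Mh) x = Mh (Ring.inverse (P.opM γ) x) := by
      intro x
      refine ext_inner_right ℝ fun v => ?_
      conv_rhs => rw [← apply_inverse_apply hM.isUnit v, ← hM.inner_apply,
        apply_inverse_apply hM.isUnit_self]
      rw [ContinuousLinearMap.adjoint_inner_left]
    simp only [opX, sub_apply, add_apply, smul_apply, ContinuousLinearMap.comp_apply,
      inverse_apply_apply hW.isUnit, h1, map_sub, map_smul]
    abel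
  have key : P.worstRegret Q₀ Q ≤ ((γ ^ 2 : ℝ) : EReal) ↔
      ∀ y, ‖(Mh ∘L Q ∘L Ring.inverse Wh - P.opX Q₀ γ Mh Wh) (Wh y)‖ ^ 2 ≤ ‖Wh y‖ ^ 2 := by
    rw [worstRegret_le_iff]
    constructor
    · intro h y
      -- This `w'` is the worst disturbance for the given `y`: it makes the remainder `e` vanish.
      have h1 := P.completed_squares Q₀ Q hγ hM y ((γ ^ 2)⁻¹ •
        Ring.inverse (1 + adj P.P₂₁ ∘L P.P₂₁) (adj P.P₁₁ (P.P₁₂ (Q y - Q₀ y))))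
      simp only [sub_self, map_zero, norm_zero] at h1
      rw [hM.inner_apply, hW.inner_apply, real_inner_self_eq_norm_sq,
        real_inner_self_eq_norm_sq, ← hz] at h1
      have h2 := (sub_nonneg.2 (h _ _)).trans_eq h1
      have h3 : 0 < γ ^ 2 := by positivity
      refine sub_nonneg.1 (nonneg_of_mul_nonneg_right ?_ h3)
      linarith
    · intro h w v
      have hS := isUnit_one_add_comp_adj P.P₂₁
      -- Every pair `(w, v)` has the parametrized form, with `y` its measurement and `w'` the
      -- deviation of `w` from the least-norm choice.
      have h1 := P.completed_squares Q₀ Q hγ hM (P.P₂₁ w + v)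
        (w - adj P.P₂₁ (Ring.inverse (1 + P.P₂₁ ∘L adj P.P₂₁) (P.P₂₁ w + v)))
      have h4 : Ring.inverse (1 + P.P₂₁ ∘L adj P.P₂₁) (P.P₂₁ w + v) +
          P.P₂₁ (adj P.P₂₁ (Ring.inverse (1 + P.P₂₁ ∘L adj P.P₂₁) (P.P₂₁ w + v))) =
            P.P₂₁ w + v := apply_inverse_apply hS _
      have h5 : Ring.inverse (1 + P.P₂₁ ∘L adj P.P₂₁) (P.P₂₁ w + v) - P.P₂₁ (w -
          adj P.P₂₁ (Ring.inverse (1 + P.P₂₁ ∘L adj P.P₂₁) (P.P₂₁ w + v))) = v := by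
        rw [map_sub, ← sub_add, sub_add_eq_add_sub, h4, add_sub_cancel_left]
      simp only [h5, add_sub_cancel] at h1
      rw [hM.inner_apply, hW.inner_apply, real_inner_self_eq_norm_sq,
        real_inner_self_eq_norm_sq, ← hz] at h1
      rw [← sub_nonneg, h1]
      have h6 := sub_nonneg.2 (h (P.P₂₁ w + v))
      positivity
  rw [key]
  constructor
  · intro h
    refine ContinuousLinearMap.opNorm_le_bound _ zero_le_one fun x => ?_
    have := h (Ring.inverse Wh x)
    rw [apply_inverse_apply hW.isUnit] at this
    rw [one_mul]
    exact (pow_le_pow_iff_left₀ (norm_nonneg _) (norm_nonneg _) two_ne_zero).1 this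
  · intro h y
    have := ContinuousLinearMap.le_of_opNorm_le _ h (Wh y)
    rw [one_mul] at this
    gcongr

variable {P}

lemma isTimeInvariant_opX {Q₀ : Op p m} (hQ₀ : IsTimeInvariant Q₀) {γ : ℝ} {Mh : Op m m}
    {Wh : Op p p} (hM : IsTimeInvariant Mh) (hW : IsTimeInvariant Wh) :
    IsTimeInvariant (P.opX Q₀ γ Mh Wh) :=
  (hM.comp (hQ₀.comp hW.inverse)).add ((hM.inverse.adj.comp (P.isTimeInvariant_opT.comp
    ((P.isTimeInvariant_Q₂.sub hQ₀).comp hW.inverse))).smul _)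

lemma IsGammaSolution.isNehariSolution {Q₀ Q : Op p m} {γ : ℝ} (hγ : 0 < γ)
    (h : P.IsGammaSolution Q₀ γ Q) (hQ₀ : IsTimeInvariant Q₀) {Mh : Op m m} {Wh : Op p p}
    (hM : IsCanonicalFactor (P.opM γ) Mh) (hW : IsCanonicalFactor (P.opW Q₀ γ) Wh) :
    IsNehariSolution (blocks (P.opX Q₀ γ Mh Wh)).antiPart
      (blocks (Mh ∘L Q ∘L Ring.inverse Wh) - (blocks (P.opX Q₀ γ Mh Wh)).causalPart) where
  toeplitz := BlockMatrix.IsToeplitz.sub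
    (hM.timeInvariant.comp (h.timeInvariant.comp hW.timeInvariant.inverse))
    (isTimeInvariant_opX hQ₀ hM.timeInvariant hW.timeInvariant).causalPart
  causal := BlockMatrix.IsCausal.sub (hM.causal.comp (h.causal.comp hW.causal_inverse))
    (BlockMatrix.isCausal_causalPart _)
  opNorm_le := by
    rw [sub_sub, BlockMatrix.causalPart_add_antiPart, ← blocks_sub, BlockMatrix.opNorm_blocks,
      ← ofReal_norm, ← ENNReal.ofReal_one]
    exact ENNReal.ofReal_le_ofReal ((P.worstRegret_le_sq_iff Q₀ Q hγ hM hW).1 h.worstRegret_le)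

/-- Boundedness comes from `C + {X}₊ = (C - {X}₋) + X`, where both summands on the right are
bounded. -/
lemma exists_isGammaSolution_of_isNehariSolution {Q₀ : Op p m} {γ : ℝ} (hγ : 0 < γ)
    (hQ₀ : IsTimeInvariant Q₀) {Mh : Op m m} {Wh : Op p p}
    (hM : IsCanonicalFactor (P.opM γ) Mh) (hW : IsCanonicalFactor (P.opW Q₀ γ) Wh)
    {C : BlockMatrix p m} (hC : IsNehariSolution (blocks (P.opX Q₀ γ Mh Wh)).antiPart C) :
    ∃ Y : Op p m, blocks Y = C + (blocks (P.opX Q₀ γ Mh Wh)).causalPart ∧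
      P.IsGammaSolution Q₀ γ (Ring.inverse Mh ∘L Y ∘L Wh) := by
  obtain ⟨A, hA⟩ := BlockMatrix.exists_of_opNorm_lt_top (hC.opNorm_le.trans_lt ENNReal.one_lt_top)
  have hA1 : ‖A‖ ≤ 1 := by
    have := hC.opNorm_le
    rw [← hA, BlockMatrix.opNorm_blocks, ← ofReal_norm, ENNReal.ofReal_le_one] at this
    exact this
  have hY : blocks (A + P.opX Q₀ γ Mh Wh) = C + (blocks (P.opX Q₀ γ Mh Wh)).causalPart := by
    rw [blocks_add, hA]
    conv_lhs => enter [2]; rw [← BlockMatrix.causalPart_add_antiPart (blocks (P.opX Q₀ γ Mh Wh))]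
    abel
  have hTY : IsTimeInvariant (A + P.opX Q₀ γ Mh Wh) := by
    rw [IsTimeInvariant, hY]
    exact hC.toeplitz.add (isTimeInvariant_opX hQ₀ hM.timeInvariant hW.timeInvariant).causalPart
  have hCY : IsCausal (A + P.opX Q₀ γ Mh Wh) := by
    rw [IsCausal, hY]
    exact hC.causal.add (BlockMatrix.isCausal_causalPart _)
  refine ⟨_, hY, hM.timeInvariant.inverse.comp (hTY.comp hW.timeInvariant),
    hM.causal_inverse.comp (hCY.comp hW.causal), (P.worstRegret_le_sq_iff Q₀ _ hγ hM hW).2 ?_⟩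
  convert hA1 using 2
  ext1 x
  simp [apply_inverse_apply hM.isUnit, apply_inverse_apply hW.isUnit]

/-- A weak limit of near-optimal controllers works: the cost is weakly lower semicontinuous in `Q`.
-/
lemma exists_isGammaSolution_of_optimalRegret_le {Q₀ : Op p m} {γ : ℝ}
    (h : P.optimalRegret Q₀ ≤ ((γ ^ 2 : ℝ) : EReal)) : ∃ Q, P.IsGammaSolution Q₀ γ Q := by
  have key : ∀ N : ℕ, ∃ Q : Op p m, IsTimeInvariant Q ∧ IsCausal Q ∧
      P.worstRegret Q₀ Q ≤ ((γ ^ 2 + 1 / ((N : ℝ) + 1) : ℝ) : EReal) := by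
    intro N
    have h1 : P.optimalRegret Q₀ < ((γ ^ 2 + 1 / ((N : ℝ) + 1) : ℝ) : EReal) := by
      refine h.trans_lt (EReal.coe_lt_coe_iff.2 ?_)
      have : (0 : ℝ) < 1 / ((N : ℝ) + 1) := by positivity
      linarith
    simp only [optimalRegret, iInf_lt_iff] at h1
    obtain ⟨Q, hT, hC, hlt⟩ := h1
    exact ⟨Q, hT, hC, hlt.le⟩
  choose Q hT hC hr using key
  simp only [worstRegret_le_iff] at hr
  -- Taking `w = 0` bounds the controllers uniformly: `‖Q v‖²` is at most the cost of `Q`, hence at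
  -- most the cost of `Q₀` plus `(γ² + 1)‖v‖²`.
  obtain ⟨B, hB⟩ := exists_weak_limit Q
    (√(‖P.P₁₂ ∘L Q₀‖ ^ 2 + ‖Q₀‖ ^ 2 + (γ ^ 2 + 1))) (fun N => by
      refine ContinuousLinearMap.opNorm_le_bound _ (Real.sqrt_nonneg _) fun v => ?_
      refine (pow_le_pow_iff_left₀ (by positivity) (by positivity) two_ne_zero).1 ?_
      rw [mul_pow, Real.sq_sqrt (by positivity)]
      have h1 := hr N 0 v
      have h2 : 1 / ((N : ℝ) + 1) ≤ 1 := (div_le_one (by positivity)).2 (by simp)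
      have h3 := (P.P₁₂ ∘L Q₀).le_opNorm v
      have h4 := Q₀.le_opNorm v
      have h5 : ‖P.P₁₂ (Q₀ v)‖ ^ 2 ≤ ‖P.P₁₂ ∘L Q₀‖ ^ 2 * ‖v‖ ^ 2 := by
        rw [← mul_pow]; exact pow_le_pow_left₀ (norm_nonneg _) h3 2
      have h6 : ‖Q₀ v‖ ^ 2 ≤ ‖Q₀‖ ^ 2 * ‖v‖ ^ 2 := by
        rw [← mul_pow]; exact pow_le_pow_left₀ (norm_nonneg _) h4 2
      have h7 := mul_le_mul_of_nonneg_right h2 (sq_nonneg ‖v‖)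
      simp only [regret, cost, regulated_eq, control_eq, map_zero, zero_add, norm_zero] at h1
      have h8 := sq_nonneg ‖P.P₁₂ (Q N v)‖
      linarith) (hyperfilter ℕ)
  refine ⟨B, isTimeInvariant_of_weak_limit hB hT, fun i j hij =>
    blocks_eq_of_weak_limit hB fun N => hC N i j hij, (P.worstRegret_le_iff _ _ _).2 fun w v => ?_⟩
  have hs : Tendsto (fun N => inner ℝ (P.regulated (Q N) w v) (P.regulated B w v)) (hyperfilter ℕ)
      (𝓝 (‖P.regulated B w v‖ ^ 2)) := by
    rw [← real_inner_self_eq_norm_sq]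
    simp only [P.regulated_eq _ w v, inner_add_left (P.P₁₁ w),
      ← ContinuousLinearMap.adjoint_inner_right P.P₁₂]
    exact (hB _ _).const_add _
  have hu : Tendsto (fun N => inner ℝ (P.control (Q N) w v) (P.control B w v)) (hyperfilter ℕ)
      (𝓝 (‖P.control B w v‖ ^ 2)) := by
    rw [← real_inner_self_eq_norm_sq]
    simp only [P.control_eq _ w v]
    exact hB _ _
  have hc : Tendsto (fun N : ℕ => (γ ^ 2 + 1 / ((N : ℝ) + 1)) * (‖w‖ ^ 2 + ‖v‖ ^ 2) +
      P.cost Q₀ w v) (hyperfilter ℕ) (𝓝 (γ ^ 2 * (‖w‖ ^ 2 + ‖v‖ ^ 2) + P.cost Q₀ w v)) := by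
    have h1 := ((((tendsto_one_div_add_atTop_nhds_zero_nat (𝕜 := ℝ)).mono_left
      Nat.hyperfilter_le_atTop).const_add (γ ^ 2)).mul_const (‖w‖ ^ 2 + ‖v‖ ^ 2)).add_const
        (P.cost Q₀ w v)
    simpa only [add_zero] using h1
  have hle := le_of_tendsto_of_tendsto
    (((hs.const_mul 2).sub_const (‖P.regulated B w v‖ ^ 2)).add
      ((hu.const_mul 2).sub_const (‖P.control B w v‖ ^ 2))) hc (Eventually.of_forall fun N => by
        have h1 := two_mul_inner_sub_le_norm_sq (P.regulated (Q N) w v) (P.regulated B w v)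
        have h2 := two_mul_inner_sub_le_norm_sq (P.control (Q N) w v) (P.control B w v)
        have h3 := hr N w v
        rw [regret] at h3
        have h4 : P.cost (Q N) w v = ‖P.regulated (Q N) w v‖ ^ 2 + ‖P.control (Q N) w v‖ ^ 2 := rfl
        simp only
        linarith)
  rw [regret]
  have h4 : P.cost B w v = ‖P.regulated B w v‖ ^ 2 + ‖P.control B w v‖ ^ 2 := rfl
  linarith

lemma optimalRegret_le {Q₀ Q : Op p m} (hT : IsTimeInvariant Q) (hC : IsCausal Q) :
    P.optimalRegret Q₀ ≤ P.worstRegret Q₀ Q :=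
  iInf_le_of_le Q (iInf₂_le hT hC)

lemma IsGammaSolution.worstRegret_eq {Q₀ Q : Op p m} {γ : ℝ} (h : P.IsGammaSolution Q₀ γ Q)
    (hopt : P.optimalRegret Q₀ = ((γ ^ 2 : ℝ) : EReal)) :
    P.worstRegret Q₀ Q = ((γ ^ 2 : ℝ) : EReal) :=
  le_antisymm h.worstRegret_le (hopt ▸ optimalRegret_le h.timeInvariant h.causal)

lemma optimalRegret_eq_iff {Q₀ : Op p m} {γ : ℝ} :
    P.optimalRegret Q₀ = ((γ ^ 2 : ℝ) : EReal) ↔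
      (∃ Q, P.IsGammaSolution Q₀ γ Q) ∧
        ∀ Q, P.IsGammaSolution Q₀ γ Q → P.worstRegret Q₀ Q = ((γ ^ 2 : ℝ) : EReal) := by
  constructor
  · exact fun h => ⟨exists_isGammaSolution_of_optimalRegret_le h.le,
      fun Q hQ => hQ.worstRegret_eq h⟩
  · rintro ⟨⟨Q, hQ⟩, h⟩
    refine le_antisymm ((optimalRegret_le hQ.timeInvariant hQ.causal).trans hQ.worstRegret_le)
      (le_iInf fun Q' => le_iInf₂ fun hT hC => ?_)
    -- A causal controller with regret strictly below `γ²` would be a `γ`-solution violating the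
    -- assumed equality.
    by_contra! hlt
    exact hlt.ne (h Q' ⟨hT, hC, hlt.le⟩)

end Plant

end RegretControl

end

open RegretControl in
theorem theorem1 {n m p q : ℕ} (P : Plant n m p q)
    (Q₀ : Op p m) (hQ₀ : IsTimeInvariant Q₀)
    (γ : ℝ) (hγ : 0 < γ)
    (Mh : Op m m) (hM : IsCanonicalFactor (P.opM γ) Mh)
    (Wh : Op p p) (hW : IsCanonicalFactor (P.opW Q₀ γ) Wh) :
    -- `Q₂` is the optimal non-causal `H₂` controller
    (IsTimeInvariant P.Q₂ ∧
      ∀ Q : Op p m, IsTimeInvariant Q → Q ≠ P.Q₂ → P.h2Cost P.Q₂ < P.h2Cost Q) ∧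
    -- the reduction to the Nehari problem, whose infimum is attained below the level one
    ((∃ Q, P.IsGammaSolution Q₀ γ Q) ↔
      nehariValue (blocks (P.opX Q₀ γ Mh Wh)).antiPart ≤ 1) ∧
    ((∃ Q, P.IsGammaSolution Q₀ γ Q) ↔
      ∃ C, IsNehariSolution (blocks (P.opX Q₀ γ Mh Wh)).antiPart C) ∧
    -- the optimal regret is `γ²` exactly when equality holds in the `γ`-problem
    (P.optimalRegret Q₀ = ((γ ^ 2 : ℝ) : EReal) ↔
      (∃ Q, P.IsGammaSolution Q₀ γ Q) ∧
        ∀ Q, P.IsGammaSolution Q₀ γ Q → P.worstRegret Q₀ Q = ((γ ^ 2 : ℝ) : EReal)) ∧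
    -- a solution of the Nehari problem gives the controller `M^{-1/2} (C + {X}₊) W^{1/2}`
    (∀ C, IsNehariSolution (blocks (P.opX Q₀ γ Mh Wh)).antiPart C →
      ∃ Y : Op p m, blocks Y = C + (blocks (P.opX Q₀ γ Mh Wh)).causalPart ∧
        P.IsGammaSolution Q₀ γ (Ring.inverse Mh ∘L Y ∘L Wh) ∧
        (P.optimalRegret Q₀ = ((γ ^ 2 : ℝ) : EReal) →
          P.worstRegret Q₀ (Ring.inverse Mh ∘L Y ∘L Wh) = P.optimalRegret Q₀)) := by
  have hsol : (∃ Q, P.IsGammaSolution Q₀ γ Q) ↔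
      ∃ C, IsNehariSolution (blocks (P.opX Q₀ γ Mh Wh)).antiPart C :=
    ⟨fun ⟨_, h⟩ => ⟨_, h.isNehariSolution hγ hQ₀ hM hW⟩, fun ⟨_, h⟩ =>
      have ⟨_, _, hY⟩ := Plant.exists_isGammaSolution_of_isNehariSolution hγ hQ₀ hM hW h
      ⟨_, hY⟩⟩
  refine ⟨⟨P.isTimeInvariant_Q₂, fun Q hQ hne => P.h2Cost_Q₂_lt hQ hne⟩,
    hsol.trans ⟨fun ⟨_, h⟩ => h.nehariValue_le, exists_isNehariSolution
      (Plant.isTimeInvariant_opX hQ₀ hM.timeInvariant hW.timeInvariant).antiPart⟩,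
    hsol, Plant.optimalRegret_eq_iff, fun C hC => ?_⟩
  obtain ⟨Y, hY, hQ⟩ := Plant.exists_isGammaSolution_of_isNehariSolution hγ hQ₀ hM hW hC
  exact ⟨Y, hY, hQ, fun hopt => (hQ.worstRegret_eq hopt).trans hopt.symm⟩
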